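/- Let $X=[0,1]$, let $\lambda$ be Lebesgue measure on $X$, and for a Borel probability measure $\mu$ on $X$ put $E_\mu=\int_0^1 x\,d\mu(x)$. Let $F\in C^1(\mathbb{R},\mathbb{R})$ satisfy $F(0)=0$. For $\varepsilon\ge 0$ define $T_\mu^\varepsilon:X\to[0,1)$ by \[ T_\mu^\varepsilon(x)=\left(2+\varepsilon F\left(\frac{1}{E_\mu}-2\right)\right)x \mod 1, \] with $T_{\delta_0}^\varepsilon\equiv 0$ for the Dirac mass $\delta_0$ at $0$. An acim is a Borel probability measure $\mu$ on $X$ that is absolutely continuous with respect to $\lambda$ and satisfies $(T_\mu^\varepsilon)_*\mu=\mu$. **Theorem.** Suppose in addition that $F(x)>0$ for all $x\neq 0$ and that $F'(x)=O\left(\frac{1}{|\log x|}\right)$ as $x\to 0+$. 1. There exists $\varepsilon_1^*>0$ such that for $0\le\varepsilon<\varepsilon_1^*$ Lebesgue measure $\lambda$ is an acim and is the only one. 2. There exists $\varepsilon_2^*\ge\varepsilon_1^*$ such that for every $\varepsilon\ge\varepsilon_2^*$ there are at least two acims: $\lambda$ is one, and another one, different from $\lambda$, is equivalent to $\lambda$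 (that is, mutually absolutely continuous with it). All the assumptions on $F$ hold, for example, for $F(x)=x^{2k}$ with an integer $k\ge 1$. -/

import Mathlib

open MeasureTheory Filter Topology Asymptotics

noncomputable section

namespace SelfConsistent

/-- The mean `E_μ = ∫₀¹ x dμ(x)` of a measure on the phase space `[0,1]`. -/
def mean (μ : Measure unitInterval) : ℝ := ∫ x, (x : ℝ) ∂μ

/-- The map `x ↦ β x mod 1` on `[0,1]`, with values in `[0,1)`. -/
def betaMap (β : ℝ) (x : unitInterval) : unitInterval :=
  ⟨Int.fract (β * (x : ℝ)), Int.fract_nonneg _, (Int.fract_lt_one _).le⟩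

open Classical in
/-- The dynamics `T_μ^ε(x) = (2 + ε F(1/E_μ - 2)) x mod 1`, with the convention that it is
identically `0` when `μ` is the Dirac mass at `0` (the only case with `E_μ = 0`). -/
def dynamics (F : ℝ → ℝ) (ε : ℝ) (μ : Measure unitInterval) : unitInterval → unitInterval :=
  if μ = Measure.dirac 0 then fun _ => 0
  else betaMap (2 + ε * F (1 / mean μ - 2))

/-- Invariant measures of the self-consistent system: Borel probability measures `μ` on `[0,1]`
with `(T_μ^ε)_* μ = μ`. -/
structure IsInvariant (F : ℝ → ℝ) (ε : ℝ) (μ : Measure unitInterval) : Prop where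
  isProbabilityMeasure : IsProbabilityMeasure μ
  map_eq : μ.map (dynamics F ε μ) = μ

/-- Invariant measures that are absolutely continuous with respect to Lebesgue measure. -/
structure IsAcim (F : ℝ → ℝ) (ε : ℝ) (μ : Measure unitInterval) : Prop where
  isInvariant : IsInvariant F ε μ
  absolutelyContinuous : μ ≪ (volume : Measure unitInterval)

/-- The assumptions on `F`: it is `C¹` on `ℝ`, vanishes at `0`, is positive elsewhere, and
`F'(x) = O(1/|log x|)` as `x → 0+`. -/
structure IsAdmissible (F : ℝ → ℝ) : Prop where
  contDiff : ContDiff ℝ 1 F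
  map_zero : F 0 = 0
  pos : ∀ x, x ≠ 0 → 0 < F x
  deriv_isBigO : deriv F =O[𝓝[>] 0] fun x => 1 / |Real.log x|

end SelfConsistent

end

namespace SelfConsistent

open Set

/-! For each fixed `β ≥ 2` the map `x ↦ β x mod 1` has exactly one acim, Parry's measure, and it is
equivalent to Lebesgue. An acim of the self-consistent system is therefore the same as a slope `β ≥
2` with `β = 2 + ε F(displacement β)` (`isAcim_iff`); `β = 2` always solves this and gives Lebesgue
measure.

Small `ε`: put `δ = β - 2`. Parry's series gives `displacement β = O(δ |log δ|)`, while the growth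
of `F'` gives `F(x) = O(x / |log x|)`. The logarithms cancel, so `F(displacement β) ≤ K δ` near `δ =
0`, which excludes `δ > 0` when `ε K < 1`. Since `displacement` is bounded, small `ε` forces `δ`
into that range.

Large `ε`: `displacement` is continuous, positive at `5/2` and bounded, so the intermediate value
theorem yields a solution `β > 2`.

Uniqueness and continuity share one estimate, `abs_setIntegral_birkhoffAverage_sub_le`: Birkhoff
averages equidistribute over initial segments at rate `1/n`, uniformly in `β`. -/

lemma coe_betaMap (β : ℝ) (x : unitInterval) : (betaMap β x : ℝ) = Int.fract (β * x) := rfl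

lemma measurable_betaMap (β : ℝ) : Measurable (betaMap β) :=
  ((measurable_subtype_coe.const_mul β).fract).subtype_mk

lemma floor_add_betaMap (β : ℝ) (x : unitInterval) :
    (⌊β * x⌋ : ℝ) + betaMap β x = β * x := by
  rw [coe_betaMap, Int.floor_add_fract]

lemma integrable_of_bounded {μ : Measure unitInterval} [IsFiniteMeasure μ]
    {φ : unitInterval → ℝ} (hφ : Measurable φ) {C : ℝ} (hC : ∀ x, |φ x| ≤ C) : Integrable φ μ :=
  Integrable.of_bound hφ.aestronglyMeasurable C (Eventually.of_forall hC)

/-! ### Change of variables by periodization -/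

/-- The `1`-periodic extension to `ℝ` of a function on `[0,1)`. -/
noncomputable def periodize (φ : unitInterval → ℝ) (y : ℝ) : ℝ :=
  φ ⟨Int.fract y, Int.fract_nonneg _, (Int.fract_lt_one _).le⟩

lemma periodic_periodize (φ : unitInterval → ℝ) : Function.Periodic (periodize φ) 1 := by
  intro y
  simp [periodize, Int.fract_add_one]

lemma intervalIntegrable_periodize {φ : unitInterval → ℝ} (hφ : Measurable φ) {C : ℝ}
    (hC : ∀ x, |φ x| ≤ C) (a b : ℝ) : IntervalIntegrable (periodize φ) volume a b := by
  refine (intervalIntegrable_const (c := C)).mono_fun' ?_ ?_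
  · exact (hφ.comp (measurable_fract.subtype_mk)).aestronglyMeasurable
  · exact Eventually.of_forall fun x => hC _

lemma setIntegral_Iic_coe (g : ℝ → ℝ) (a : unitInterval) :
    ∫ x in Iic a, g x = ∫ x in (0 : ℝ)..a, g x := by
  have h1 : (Iic a : Set unitInterval) = (↑) ⁻¹' (Iic (a : ℝ)) := by ext; simp
  rw [h1, unitInterval.measurePreserving_coe.setIntegral_preimage_emb
    unitInterval.measurableEmbedding_coe, Measure.restrict_restrict measurableSet_Iic,
    intervalIntegral.integral_of_le a.2.1, ← integral_Icc_eq_integral_Ioc]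
  congr 2
  ext x
  simp only [mem_inter_iff, mem_Iic, mem_Icc]
  exact ⟨fun h => ⟨h.2.1, h.1⟩, fun h => ⟨h.2, h.1, h.2.trans a.2.2⟩⟩

lemma setIntegral_Iic_eq_periodize (φ : unitInterval → ℝ) (a : unitInterval) :
    ∫ x in Iic a, φ x = ∫ x in (0 : ℝ)..a, periodize φ x := by
  rw [← setIntegral_Iic_coe]
  refine setIntegral_congr_ae measurableSet_Iic ?_
  filter_upwards [compl_mem_ae_iff.2 (measure_singleton (1 : unitInterval))] with x hx _
  have hx1 : (x : ℝ) < 1 := lt_of_le_of_ne x.2.2 fun h => hx (Subtype.ext h)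
  simp only [periodize]
  congr 1
  exact Subtype.ext (Int.fract_eq_self.2 ⟨x.2.1, hx1⟩).symm

/-- Change of variables for `x ↦ β x mod 1` on an initial segment of `[0,1]`. -/
lemma setIntegral_Iic_comp_betaMap {β : ℝ} (hβ : 2 ≤ β) {φ : unitInterval → ℝ} (hφ : Measurable φ)
    {C : ℝ} (hC : ∀ x, |φ x| ≤ C) (a : unitInterval) :
    ∫ x in Iic a, φ (betaMap β x) =
      β⁻¹ * (⌊β * a⌋ * (∫ x, φ x) + ∫ x in Iic (betaMap β a), φ x) := by
  have h0 : ∫ x in Iic a, φ (betaMap β x) = ∫ x in (0 : ℝ)..a, periodize φ (β * x) :=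
    setIntegral_Iic_coe (fun x => periodize φ (β * x)) a
  have h1 : ∫ x, φ x = ∫ x in (0 : ℝ)..1, periodize φ x := by
    have := setIntegral_Iic_eq_periodize φ 1
    rwa [show (Iic 1 : Set unitInterval) = univ from eq_univ_of_forall fun x => x.2.2,
      setIntegral_univ] at this
  have hint := intervalIntegrable_periodize hφ hC
  -- Split `[0, β a]` at `⌊β a⌋`: whole periods first, then the fractional remainder, translated
  -- back to `0` in `h3`.
  have h2 := (periodic_periodize φ).intervalIntegral_add_zsmul_eq ⌊β * a⌋ 0 hint
  have h3 : ∫ x in ((⌊β * a⌋ : ℤ) : ℝ)..β * a, periodize φ x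
      = ∫ x in (0 : ℝ)..betaMap β a, periodize φ x := by
    have h4 := intervalIntegral.integral_comp_add_right (a := 0) (b := (betaMap β a : ℝ))
      (periodize φ) (⌊β * a⌋ : ℝ)
    rw [zero_add, add_comm (betaMap β a : ℝ), floor_add_betaMap] at h4
    rw [← h4]
    refine intervalIntegral.integral_congr fun x _ => ?_
    have := (periodic_periodize φ).int_mul ⌊β * a⌋ x
    simpa using this
  rw [h0, intervalIntegral.integral_comp_mul_left _ (by positivity), h1,
    setIntegral_Iic_eq_periodize, ← h3, mul_zero, smul_eq_mul]
  simp only [zero_add, zsmul_eq_mul, mul_one] at h2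
  rw [← h2, intervalIntegral.integral_add_adjacent_intervals (hint _ _) (hint _ _)]

/-! ### Birkhoff averages and their equidistribution -/

lemma measurable_birkhoffAverage {T : unitInterval → unitInterval} (hT : Measurable T)
    {φ : unitInterval → ℝ} (hφ : Measurable φ) (n : ℕ) :
    Measurable (birkhoffAverage ℝ T φ n) := by
  have : birkhoffAverage ℝ T φ n
      = fun x => (n : ℝ)⁻¹ • ∑ k ∈ Finset.range n, φ (T^[k] x) := rfl
  rw [this]
  exact (Finset.measurable_fun_sum _ fun k _ => hφ.comp (hT.iterate k)).const_mul (n : ℝ)⁻¹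

lemma abs_birkhoffAverage_le {T : unitInterval → unitInterval}
    {φ : unitInterval → ℝ} {C : ℝ} (hC : ∀ x, |φ x| ≤ C) (n : ℕ) (x : unitInterval) :
    |birkhoffAverage ℝ T φ n x| ≤ C := by
  have hC0 : 0 ≤ C := (abs_nonneg _).trans (hC x)
  have h1 : |∑ k ∈ Finset.range n, φ (T^[k] x)| ≤ n * C := by
    refine (Finset.abs_sum_le_sum_abs _ _).trans ?_
    simpa using Finset.sum_le_sum fun k (_ : k ∈ Finset.range n) => hC (T^[k] x)
  simp only [birkhoffAverage, birkhoffSum, smul_eq_mul, abs_mul, abs_inv, Nat.abs_cast]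
  rcases n.eq_zero_or_pos with rfl | hn
  · simpa using hC0
  · rw [inv_mul_le_iff₀ (by positivity)]
    exact h1

lemma integral_birkhoffAverage {T : unitInterval → unitInterval} {μ : Measure unitInterval}
    [IsFiniteMeasure μ] (hT : MeasurePreserving T μ μ)
    {φ : unitInterval → ℝ} (hφ : Measurable φ) {C : ℝ} (hC : ∀ x, |φ x| ≤ C) {n : ℕ} (hn : n ≠ 0) :
    ∫ x, birkhoffAverage ℝ T φ n x ∂μ = ∫ x, φ x ∂μ := by
  have h (k : ℕ) : ∫ x, φ (T^[k] x) ∂μ = ∫ x, φ x ∂μ := by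
    have hk := hT.iterate k
    conv_rhs => rw [← hk.map_eq]
    rw [integral_map hk.measurable.aemeasurable hφ.aestronglyMeasurable]
  simp only [birkhoffAverage, birkhoffSum, smul_eq_mul]
  have hi (k : ℕ) : Integrable (fun x => φ (T^[k] x)) μ :=
    integrable_of_bounded (hφ.comp (hT.measurable.iterate k)) fun x => hC _
  rw [integral_const_mul, integral_finsetSum _ fun k _ => hi k]
  simp only [h, Finset.sum_const, Finset.card_range, nsmul_eq_mul]
  field_simp

/-- Birkhoff averages of `x ↦ β x mod 1` equidistribute, with respect to Lebesgue measure, over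
initial segments. -/
lemma abs_setIntegral_birkhoffAverage_sub_le {β : ℝ} (hβ : 2 ≤ β) {φ : unitInterval → ℝ}
    (hφ : Measurable φ) {C : ℝ} (hC : ∀ x, |φ x| ≤ C) (n : ℕ) (a : unitInterval) :
    |(∫ x in Iic a, birkhoffAverage ℝ (betaMap β) φ n x)
      - a * ∫ x, birkhoffAverage ℝ (betaMap β) φ n x| ≤ 4 * C / n := by
  have hC0 : 0 ≤ C := (abs_nonneg _).trans (hC 0)
  set ψ := birkhoffAverage ℝ (betaMap β) φ n with hψ
  have hψm : Measurable ψ := measurable_birkhoffAverage (measurable_betaMap β) hφ n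
  have hψC : ∀ x, |ψ x| ≤ C := abs_birkhoffAverage_le hC n
  have hi : Integrable ψ := integrable_of_bounded hψm hψC
  have hiT : Integrable (fun x => ψ (betaMap β x)) :=
    integrable_of_bounded (hψm.comp (measurable_betaMap β)) fun x => hψC _
  set D : unitInterval → ℝ := fun a => (∫ x in Iic a, ψ x) - a * ∫ x, ψ x with hD
  -- Replacing `ψ` by `ψ ∘ betaMap β` costs at most `2C/n`, as the average telescopes; the change of
  -- variables then contracts the discrepancy `D` by `β⁻¹`.
  have hstep (a : unitInterval) : |D a| ≤ β⁻¹ * |D (betaMap β a)| + 2 * C / n := by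
    have h1 : |(∫ x in Iic a, ψ (betaMap β x)) - ∫ x in Iic a, ψ x| ≤ 2 * C / n := by
      rw [← integral_sub hiT.integrableOn hi.integrableOn]
      have := norm_setIntegral_le_of_norm_le_const (μ := volume) (s := Iic a) (C := 2 * C / n)
        (f := fun x => ψ (betaMap β x) - ψ x) (measure_lt_top _ _) ?_
      · refine this.trans (mul_le_of_le_one_right (by positivity) measureReal_le_one)
      · intro x _
        rw [hψ, birkhoffAverage_apply_sub_birkhoffAverage, norm_smul, Real.norm_eq_abs,
          Real.norm_eq_abs, abs_inv, Nat.abs_cast, div_eq_inv_mul]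
        gcongr
        have h1 := abs_sub (φ ((betaMap β)^[n] x)) (φ x)
        linarith [hC ((betaMap β)^[n] x), hC x]
    have h2 : (∫ x in Iic a, ψ (betaMap β x)) - a * ∫ x, ψ x = β⁻¹ * D (betaMap β a) := by
      rw [setIntegral_Iic_comp_betaMap hβ hψm hψC]
      have : (a : ℝ) = β⁻¹ * (⌊β * a⌋ + betaMap β a) := by
        rw [floor_add_betaMap]; field_simp
      linear_combination -(∫ x, ψ x) * this
    have h3 : D a = β⁻¹ * D (betaMap β a)
        - ((∫ x in Iic a, ψ (betaMap β x)) - ∫ x in Iic a, ψ x) := by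
      rw [← h2]; simp only [hD]; ring
    rw [h3]
    refine (abs_sub _ _).trans ?_
    rw [abs_mul, abs_of_pos (by positivity : 0 < β⁻¹)]
    gcongr
  have hbdd : BddAbove (range fun a => |D a|) := by
    refine ⟨2 * C, ?_⟩
    rintro _ ⟨a, rfl⟩
    have e1 : |∫ x in Iic a, ψ x| ≤ C :=
      (norm_setIntegral_le_of_norm_le_const (μ := volume) (f := ψ) (measure_lt_top _ _)
        fun x _ => hψC x).trans (mul_le_of_le_one_right hC0 measureReal_le_one)
    have e2 : |∫ x, ψ x| ≤ C := by
      have := norm_integral_le_of_norm_le_const (μ := volume) (f := ψ) (Eventually.of_forall hψC)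
      simpa using this
    have e3 : |(a : ℝ) * ∫ x, ψ x| ≤ C := by
      rw [abs_mul, abs_of_nonneg a.2.1]
      exact (mul_le_of_le_one_left (abs_nonneg _) a.2.2).trans e2
    have := abs_sub (∫ x in Iic a, ψ x) (a * ∫ x, ψ x)
    simp only [hD]
    linarith
  have hβi : β⁻¹ ≤ 2⁻¹ := by gcongr
  -- With `S = sup |D|`, this is `S ≤ S/2 + 2C/n`, so `S ≤ 4C/n`.
  have hsup : ⨆ a, |D a| ≤ 2⁻¹ * (⨆ a, |D a|) + 2 * C / n := by
    refine ciSup_le fun a => (hstep a).trans ?_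
    have := le_ciSup hbdd (betaMap β a)
    gcongr
  have := le_ciSup hbdd a
  have e : 4 * C / n = 2 * (2 * C / n) := by ring
  change |D a| ≤ _
  linarith

/-! ### From initial segments to integrable test functions -/

section WeakConvergence

variable {θ : ℕ → unitInterval → ℝ} {C : ℝ}

/-- A π-λ argument; the uniform bound on `θ` supplies the dominating series for disjoint unions. -/
lemma tendsto_setIntegral_of_Iic (hθ : ∀ n, Measurable (θ n)) (hC : ∀ n x, |θ n x| ≤ C)
    (h : ∀ a, Tendsto (fun n => ∫ x in Iic a, θ n x) atTop (𝓝 0)) {s : Set unitInterval}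
    (hs : MeasurableSet s) : Tendsto (fun n => ∫ x in s, θ n x) atTop (𝓝 0) := by
  have hi (n : ℕ) : Integrable (θ n) := integrable_of_bounded (hθ n) (hC n)
  induction s, hs using MeasurableSpace.induction_on_inter
    ((BorelSpace.measurable_eq (α := unitInterval)).trans (borel_eq_generateFrom_Iic unitInterval))
    isPiSystem_Iic with
  | empty => simp
  | basic t ht =>
    obtain ⟨a, rfl⟩ := ht
    exact h a
  | compl t htm ht =>
    have h1 := h 1
    rw [show (Iic 1 : Set unitInterval) = univ from eq_univ_of_forall fun x => x.2.2] at h1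
    have := h1.sub ht
    simp only [setIntegral_univ, sub_zero] at this
    refine this.congr fun n => ?_
    rw [← integral_add_compl htm (hi n)]
    ring
  | iUnion f hd hm hf =>
    have hsum : Summable fun i => C * volume.real (f i) :=
      (summable_measure_toReal hm hd).mul_left C
    have := tendsto_tsum_of_dominated_convergence hsum hf (Eventually.of_forall fun n i =>
      norm_setIntegral_le_of_norm_le_const (measure_lt_top _ _) fun x _ => hC n x)
    rw [tsum_zero] at this
    refine this.congr fun n => ?_
    rw [integral_iUnion hm hd (hi n).integrableOn]

/-- Simple functions are dense in `L¹`, and the uniform bound on `θ` makes the convergence stable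
under `L¹` limits. -/
lemma tendsto_integral_mul_of_Iic (hθ : ∀ n, Measurable (θ n)) (hC : ∀ n x, |θ n x| ≤ C)
    (h : ∀ a, Tendsto (fun n => ∫ x in Iic a, θ n x) atTop (𝓝 0)) {f : unitInterval → ℝ}
    (hf : Integrable f) : Tendsto (fun n => ∫ x, f x * θ n x) atTop (𝓝 0) := by
  have hC0 : 0 ≤ C := (abs_nonneg _).trans (hC 0 0)
  have hmul {g : unitInterval → ℝ} (hg : Integrable g) (n : ℕ) :
      Integrable fun x => g x * θ n x :=
    hg.mul_bdd (c := C) (hθ n).aestronglyMeasurable (Eventually.of_forall fun x => hC n x)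
  refine Integrable.induction (P := fun f => Tendsto (fun n => ∫ x, f x * θ n x) atTop (𝓝 0))
    ?_ ?_ ?_ ?_ hf
  · intro c s hs _
    have := (tendsto_setIntegral_of_Iic hθ hC h hs).const_mul c
    rw [mul_zero] at this
    refine this.congr fun n => ?_
    rw [← integral_const_mul, ← integral_indicator hs]
    refine integral_congr_ae (Eventually.of_forall fun x => ?_)
    by_cases hx : x ∈ s <;> simp [hx]
  · intro f g _ hf hg hf' hg'
    have := hf'.add hg'
    rw [add_zero] at this
    refine this.congr fun n => ?_
    rw [← integral_add (hmul hf n) (hmul hg n)]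
    simp [add_mul]
  · refine isClosed_of_closure_subset fun f hf => ?_
    refine Metric.tendsto_atTop.2 fun ε hε => ?_
    obtain ⟨g, hg, hfg⟩ := Metric.mem_closure_iff.1 hf (ε / 2 / (C + 1)) (by positivity)
    obtain ⟨N, hN⟩ := Metric.tendsto_atTop.1 hg (ε / 2) (by positivity)
    refine ⟨N, fun n hn => ?_⟩
    have h1 := hN n hn
    rw [Real.dist_eq, sub_zero] at h1 ⊢
    have hfi := L1.integrable_coeFn f
    have hgi := L1.integrable_coeFn g
    have h2 : |(∫ x, f x * θ n x) - ∫ x, g x * θ n x| ≤ dist f g * C := by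
      rw [← integral_sub (hmul hfi n) (hmul hgi n), L1.dist_eq_integral_dist,
        ← integral_mul_const]
      refine norm_integral_le_of_norm_le (f := fun x => f x * θ n x - g x * θ n x)
        (g := fun x => dist (f x) (g x) * C) ?_ (Eventually.of_forall fun x => ?_)
      · simpa [Real.dist_eq] using ((hfi.sub hgi).norm.mul_const C)
      · rw [← sub_mul, norm_mul, Real.dist_eq]
        exact mul_le_mul_of_nonneg_left (hC n x) (abs_nonneg _)
    have h3 : dist f g * C ≤ ε / 2 := by
      calc dist f g * C ≤ ε / 2 / (C + 1) * (C + 1) := by gcongr; linarith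
        _ = ε / 2 := by field_simp
    have h4 := abs_sub_abs_le_abs_sub (∫ x, f x * θ n x) (∫ x, g x * θ n x)
    linarith
  · intro f g hfg hf hf'
    refine hf'.congr fun n => integral_congr_ae ?_
    filter_upwards [hfg] with x hx
    rw [hx]

end WeakConvergence

/-! ### Uniqueness of the acim for fixed slope -/

/-- The integral of a bounded function against an absolutely continuous invariant probability
measure of `x ↦ β x mod 1` is determined by Lebesgue integrals of Birkhoff averages. -/
lemma tendsto_integral_birkhoffAverage {β : ℝ} (hβ : 2 ≤ β) {μ : Measure unitInterval}
    [IsProbabilityMeasure μ] (hμ : μ ≪ volume) (hT : MeasurePreserving (betaMap β) μ μ)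
    {φ : unitInterval → ℝ} (hφ : Measurable φ) {C : ℝ} (hC : ∀ x, |φ x| ≤ C) :
    Tendsto (fun n => ∫ x, birkhoffAverage ℝ (betaMap β) φ n x) atTop (𝓝 (∫ x, φ x ∂μ)) := by
  set ψ := birkhoffAverage ℝ (betaMap β) φ with hψ
  have hψm (n : ℕ) : Measurable (ψ n) := measurable_birkhoffAverage (measurable_betaMap β) hφ n
  have hψC (n : ℕ) : ∀ x, |ψ n x| ≤ C := abs_birkhoffAverage_le hC n
  have hψi (ν : Measure unitInterval) [IsFiniteMeasure ν] (n : ℕ) : Integrable (ψ n) ν :=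
    integrable_of_bounded (hψm n) (hψC n)
  set c : ℕ → ℝ := fun n => ∫ x, ψ n x with hc
  have hcC (n : ℕ) : |c n| ≤ C := by
    have := norm_integral_le_of_norm_le_const (μ := volume) (f := ψ n)
      (Eventually.of_forall (hψC n))
    simpa using this
  -- Test against the density of `μ`: by invariance the pairing with `ψ n - c n` is `∫ φ dμ - c n`,
  -- and `c n` does not depend on `μ`.
  have key := tendsto_integral_mul_of_Iic (θ := fun n x => ψ n x - c n) (C := C + C)
    (fun n => (hψm n).sub_const _) (fun n x => (abs_sub _ _).trans (add_le_add (hψC n x) (hcC n)))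
    (fun a => ?_) (f := fun x => (μ.rnDeriv volume x).toReal) Measure.integrable_toReal_rnDeriv
  · have h1 : Tendsto (fun n => (∫ x, φ x ∂μ) - c n) atTop (𝓝 0) := by
      refine key.congr' ?_
      filter_upwards [eventually_ne_atTop 0] with n hn
      rw [integral_toReal_rnDeriv_mul hμ, integral_sub (hψi μ n) (integrable_const _),
        integral_birkhoffAverage hT hφ hC hn]
      simp
    have := h1.const_sub (∫ x, φ x ∂μ)
    simpa using this
  · refine (tendsto_zero_iff_abs_tendsto_zero _).2 ?_
    refine squeeze_zero (fun n => abs_nonneg _) (fun n => ?_)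
      (tendsto_const_div_atTop_nhds_zero_nat (4 * C))
    have h2 := abs_setIntegral_birkhoffAverage_sub_le hβ hφ hC n a
    have h3 : ∫ x in Iic a, (ψ n x - c n) = (∫ x in Iic a, ψ n x) - a * c n := by
      rw [integral_sub (hψi volume n).integrableOn (integrable_const _)]
      simp [Measure.real, unitInterval.volume_Iic, a.2.1]
    simpa only [Function.comp_apply, h3] using h2

/-- For `β ≥ 2`, the map `x ↦ β x mod 1` has at most one absolutely continuous invariant
probability measure. -/
lemma eq_of_measurePreserving_betaMap {β : ℝ} (hβ : 2 ≤ β) {μ ν : Measure unitInterval}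
    [IsProbabilityMeasure μ] [IsProbabilityMeasure ν] (hμ : μ ≪ volume) (hν : ν ≪ volume)
    (hTμ : MeasurePreserving (betaMap β) μ μ) (hTν : MeasurePreserving (betaMap β) ν ν) :
    μ = ν := by
  ext s hs
  have hm : Measurable (s.indicator (1 : unitInterval → ℝ)) := measurable_one.indicator hs
  have hb (x : unitInterval) : |s.indicator (1 : unitInterval → ℝ) x| ≤ 1 := by
    by_cases hx : x ∈ s <;> simp [hx]
  have h := tendsto_nhds_unique (tendsto_integral_birkhoffAverage hβ hμ hTμ hm hb)
    (tendsto_integral_birkhoffAverage hβ hν hTν hm hb)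
  rw [integral_indicator_one hs, integral_indicator_one hs] at h
  exact (measureReal_eq_measureReal_iff).1 h

/-! ### Parry's invariant measure -/

/-- The orbit of `1` under `x ↦ β x mod 1`. -/
noncomputable def orbitOne (β : ℝ) (k : ℕ) : unitInterval := (betaMap β)^[k] 1

lemma orbitOne_zero (β : ℝ) : orbitOne β 0 = 1 := rfl

lemma orbitOne_succ (β : ℝ) (k : ℕ) : orbitOne β (k + 1) = betaMap β (orbitOne β k) :=
  Function.iterate_succ_apply' _ _ _

/-- Parry's invariant measure of `x ↦ β x mod 1`, not normalized. -/
noncomputable def parrySum (β : ℝ) : Measure unitInterval :=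
  Measure.sum fun k => ENNReal.ofReal (β⁻¹ ^ k) • volume.restrict (Iic (orbitOne β k))

/-- The total mass of `parrySum β`. -/
noncomputable def parryMass (β : ℝ) : ℝ := ∑' k, β⁻¹ ^ k * (orbitOne β k : ℝ)

/-- Twice the first moment of `parrySum β`. -/
noncomputable def parryMoment (β : ℝ) : ℝ := ∑' k, β⁻¹ ^ k * (orbitOne β k : ℝ) ^ 2

/-- The invariant probability measure of `x ↦ β x mod 1` found by Parry. -/
noncomputable def parryMeasure (β : ℝ) : Measure unitInterval :=
  (parrySum β univ)⁻¹ • parrySum β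

variable {β : ℝ}

lemma inv_pow_le (hβ : 2 ≤ β) (k : ℕ) : β⁻¹ ^ k ≤ (1 / 2 : ℝ) ^ k := by
  have : β⁻¹ ≤ 1 / 2 := by rw [← one_div]; gcongr
  gcongr

lemma hasSum_inv_pow (hβ : 2 ≤ β) : HasSum (fun k : ℕ => β⁻¹ ^ k) (1 - β⁻¹)⁻¹ :=
  hasSum_geometric_of_lt_one (by positivity) (inv_lt_one_of_one_lt₀ (by linarith))

lemma tsum_inv_pow_le (hβ : 2 ≤ β) : ∑' k : ℕ, β⁻¹ ^ k ≤ 2 := by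
  rw [(hasSum_inv_pow hβ).tsum_eq]
  have : β⁻¹ ≤ 1 / 2 := by rw [← one_div]; gcongr
  rw [inv_le_comm₀ (by linarith) (by norm_num)]
  linarith

lemma summable_inv_pow_mul (hβ : 2 ≤ β) {g : ℕ → ℝ} {C : ℝ} (hg : ∀ k, |g k| ≤ C) :
    Summable fun k : ℕ => β⁻¹ ^ k * g k := by
  refine Summable.of_norm_bounded ((hasSum_inv_pow hβ).summable.mul_right C) fun k => ?_
  rw [norm_mul, Real.norm_of_nonneg (by positivity)]
  gcongr
  exact hg k

lemma abs_coe_le_one (x : unitInterval) : |(x : ℝ)| ≤ 1 := by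
  rw [abs_of_nonneg x.2.1]; exact x.2.2

lemma summable_parryMass (hβ : 2 ≤ β) : Summable fun k => β⁻¹ ^ k * (orbitOne β k : ℝ) :=
  summable_inv_pow_mul hβ fun _ => abs_coe_le_one _

lemma summable_parryMoment (hβ : 2 ≤ β) : Summable fun k => β⁻¹ ^ k * (orbitOne β k : ℝ) ^ 2 :=
  summable_inv_pow_mul (C := 1) hβ fun k => by
    rw [abs_pow]; exact pow_le_one₀ (abs_nonneg _) (abs_coe_le_one _)

lemma parrySum_univ (hβ : 2 ≤ β) : parrySum β univ = ENNReal.ofReal (parryMass β) := by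
  have h0 : 0 ≤ β := by linarith
  rw [parrySum, Measure.sum_apply _ MeasurableSet.univ, parryMass,
    ENNReal.ofReal_tsum_of_nonneg (fun k => mul_nonneg (by positivity) (orbitOne β k).2.1)
      (summable_parryMass hβ)]
  congr 1 with k
  rw [ENNReal.ofReal_mul (by positivity : 0 ≤ β⁻¹ ^ k)]
  simp [unitInterval.volume_Iic]

lemma isFiniteMeasure_parrySum (hβ : 2 ≤ β) : IsFiniteMeasure (parrySum β) :=
  ⟨by rw [parrySum_univ hβ]; exact ENNReal.ofReal_lt_top⟩

lemma hasSum_integral_parrySum (hβ : 2 ≤ β) {φ : unitInterval → ℝ} (hφ : Measurable φ) {C : ℝ}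
    (hC : ∀ x, |φ x| ≤ C) :
    HasSum (fun k => β⁻¹ ^ k * ∫ x in Iic (orbitOne β k), φ x) (∫ x, φ x ∂(parrySum β)) := by
  have := isFiniteMeasure_parrySum hβ
  have h0 : 0 ≤ β := by linarith
  have h : Integrable φ (parrySum β) := integrable_of_bounded hφ hC
  have := hasSum_integral_measure h
  refine this.congr_fun fun k => ?_
  rw [integral_smul_measure, ENNReal.toReal_ofReal (by positivity), smul_eq_mul]

lemma Iic_one : (Iic 1 : Set unitInterval) = univ := eq_univ_of_forall fun x => x.2.2

/-- The `β`-expansion of `1`: as `⌊β x_k⌋ = β x_k - x_{k+1}` along the orbit, the series telescopes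
to `x_0 = 1`. -/
lemma hasSum_inv_pow_mul_floor (hβ : 2 ≤ β) :
    HasSum (fun k => β⁻¹ ^ k * (β⁻¹ * ⌊β * orbitOne β k⌋)) 1 := by
  have h1 := (summable_parryMass hβ).hasSum
  have h2 := (hasSum_nat_add_iff' 1).2 h1
  have h3 := h1.sub h2
  simp only [Finset.range_one, Finset.sum_singleton, pow_zero, orbitOne_zero, one_mul,
    sub_sub_cancel] at h3
  rw [show ((1 : unitInterval) : ℝ) = 1 from rfl] at h3
  refine h3.congr_fun fun k => ?_
  have := floor_add_betaMap β (orbitOne β k)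
  rw [orbitOne_succ, eq_sub_of_add_eq this, pow_succ]
  field_simp

/-- Composing with the map turns the `k`-th term into the `(k+1)`-st plus a multiple of `∫ φ`. The
shift loses the term `k = 0`, which is `∫ φ`; the multiples restore it, since they sum to `1`. -/
lemma measurePreserving_parrySum (hβ : 2 ≤ β) :
    MeasurePreserving (betaMap β) (parrySum β) (parrySum β) := by
  have := isFiniteMeasure_parrySum hβ
  have hT := measurable_betaMap β
  have key {φ : unitInterval → ℝ} (hφ : Measurable φ) {C : ℝ} (hC : ∀ x, |φ x| ≤ C) :
      ∫ x, φ (betaMap β x) ∂(parrySum β) = ∫ x, φ x ∂(parrySum β) := by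
    have h1 := hasSum_integral_parrySum hβ (hφ.comp hT) (fun x => hC _)
    have h2 := hasSum_integral_parrySum hβ hφ hC
    have h3 := (hasSum_nat_add_iff' 1).2 h2
    simp only [Finset.range_one, Finset.sum_singleton, pow_zero, orbitOne_zero, one_mul,
      Iic_one, setIntegral_univ] at h3
    have h4 := ((hasSum_inv_pow_mul_floor hβ).mul_right (∫ x, φ x)).add h3
    rw [one_mul, add_sub_cancel] at h4
    refine h1.unique ?_
    refine h4.congr_fun fun k => ?_
    rw [Function.comp_def, setIntegral_Iic_comp_betaMap hβ hφ hC, orbitOne_succ]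
    ring
  refine ⟨hT, ?_⟩
  ext s hs
  have h := key (measurable_one.indicator hs) (φ := s.indicator 1) (C := 1) fun x => by
    by_cases hx : x ∈ s <;> simp [hx]
  have e : (fun x => s.indicator (1 : unitInterval → ℝ) (betaMap β x))
      = (betaMap β ⁻¹' s).indicator 1 := rfl
  rw [e, integral_indicator_one hs, integral_indicator_one (hT hs)] at h
  rw [Measure.map_apply hT hs]
  exact (measureReal_eq_measureReal_iff).1 h

lemma one_le_parryMoment (hβ : 2 ≤ β) : 1 ≤ parryMoment β := by
  have h0 : 0 ≤ β := by linarith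
  have := (summable_parryMoment hβ).le_tsum 0 fun k _ => by positivity
  simpa [orbitOne_zero, parryMoment] using this

lemma parryMoment_le_parryMass (hβ : 2 ≤ β) : parryMoment β ≤ parryMass β := by
  have h0 : 0 ≤ β := by linarith
  refine (summable_parryMoment hβ).tsum_le_tsum (fun k => ?_) (summable_parryMass hβ)
  have := (orbitOne β k).2
  have : (orbitOne β k : ℝ) ^ 2 ≤ orbitOne β k := by nlinarith [this.1, this.2]
  gcongr

lemma one_le_parryMass (hβ : 2 ≤ β) : 1 ≤ parryMass β :=
  (one_le_parryMoment hβ).trans (parryMoment_le_parryMass hβ)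

lemma parryMass_le_two (hβ : 2 ≤ β) : parryMass β ≤ 2 := by
  have h0 : 0 ≤ β := by linarith
  refine le_trans ?_ (tsum_inv_pow_le hβ)
  refine (summable_parryMass hβ).tsum_le_tsum (fun k => ?_) (hasSum_inv_pow hβ).summable
  exact mul_le_of_le_one_right (by positivity) (orbitOne β k).2.2

lemma integral_parryMeasure (hβ : 2 ≤ β) (φ : unitInterval → ℝ) :
    ∫ x, φ x ∂(parryMeasure β) = (parryMass β)⁻¹ * ∫ x, φ x ∂(parrySum β) := by
  have := one_le_parryMass hβ
  rw [parryMeasure, integral_smul_measure, parrySum_univ hβ, ENNReal.toReal_inv,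
    ENNReal.toReal_ofReal (by linarith), smul_eq_mul]

lemma parrySum_univ_ne_zero (hβ : 2 ≤ β) : parrySum β univ ≠ 0 := by
  rw [parrySum_univ hβ]
  exact (ENNReal.ofReal_pos.2 (by linarith [one_le_parryMass hβ])).ne'

lemma isProbabilityMeasure_parryMeasure (hβ : 2 ≤ β) : IsProbabilityMeasure (parryMeasure β) := by
  have := isFiniteMeasure_parrySum hβ
  refine ⟨?_⟩
  rw [parryMeasure, Measure.smul_apply, smul_eq_mul,
    ENNReal.inv_mul_cancel (parrySum_univ_ne_zero hβ) (measure_ne_top _ _)]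

lemma measurePreserving_parryMeasure (hβ : 2 ≤ β) :
    MeasurePreserving (betaMap β) (parryMeasure β) (parryMeasure β) :=
  (measurePreserving_parrySum hβ).smul_measure _

lemma parryMeasure_absolutelyContinuous (β : ℝ) : parryMeasure β ≪ volume := by
  refine Measure.AbsolutelyContinuous.smul_left ?_ _
  refine Measure.absolutelyContinuous_sum_left fun k => ?_
  exact (Measure.absolutelyContinuous_of_le Measure.restrict_le_self).smul_left _

/-- The orbit starts at `1`, so the term `k = 0` of the sum is Lebesgue measure itself. -/
lemma absolutelyContinuous_parryMeasure (hβ : 2 ≤ β) : volume ≪ parryMeasure β := by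
  have := isFiniteMeasure_parrySum hβ
  have h : volume ≪ parrySum β := by
    refine Measure.absolutelyContinuous_sum_right 0 ?_
    simp [orbitOne_zero, Iic_one, Measure.AbsolutelyContinuous.rfl]
  exact h.trans (Measure.absolutelyContinuous_smul
    (ENNReal.inv_ne_zero.2 (measure_ne_top _ _)))

lemma mean_parryMeasure (hβ : 2 ≤ β) :
    mean (parryMeasure β) = parryMoment β / (2 * parryMass β) := by
  have h1 := hasSum_integral_parrySum hβ measurable_subtype_coe abs_coe_le_one
  have h2 (a : unitInterval) : ∫ x in Iic a, (x : ℝ) = (a : ℝ) ^ 2 / 2 := by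
    rw [setIntegral_Iic_coe (fun x => x)]
    simp
  have h3 : ∫ x, (x : ℝ) ∂(parrySum β) = parryMoment β / 2 := by
    refine h1.unique ?_
    have := (summable_parryMoment hβ).hasSum.div_const 2
    simp only [h2]
    refine this.congr_fun fun k => ?_
    rw [mul_div_assoc]
  have := one_le_parryMass hβ
  rw [mean, integral_parryMeasure hβ, h3]
  field_simp

/-- The displacement `1 / E - 2` of the mean of the invariant measure of `x ↦ β x mod 1`. -/
lemma one_div_mean_parryMeasure_sub (hβ : 2 ≤ β) :
    1 / mean (parryMeasure β) - 2 = 2 * (parryMass β - parryMoment β) / parryMoment β := by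
  have h1 := one_le_parryMass hβ
  have h2 := one_le_parryMoment hβ
  rw [mean_parryMeasure hβ]
  field_simp

/-- The orbit of `1` falls to `0` at once, so only the term `k = 0` survives. -/
lemma parryMeasure_two : parryMeasure 2 = volume := by
  have h (k : ℕ) : orbitOne 2 (k + 1) = 0 := by
    induction k with
    | zero =>
      rw [orbitOne_succ, orbitOne_zero]
      refine Subtype.ext ?_
      rw [coe_betaMap]
      simp
    | succ k ih =>
      rw [orbitOne_succ, ih]
      refine Subtype.ext ?_
      rw [coe_betaMap]
      simp
  have h1 : parrySum 2 = volume := by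
    ext s hs
    rw [parrySum, Measure.sum_apply _ hs, tsum_eq_single 0]
    · simp [orbitOne_zero, Iic_one]
    · intro k hk
      obtain ⟨j, rfl⟩ := Nat.exists_eq_succ_of_ne_zero hk
      have : volume.restrict (Iic (0 : unitInterval)) = 0 := by
        rw [Measure.restrict_eq_zero, unitInterval.volume_Iic]
        simp
      rw [Nat.succ_eq_add_one, h, this]
      simp
  rw [parryMeasure, h1]
  simp

lemma map_betaMap_eq_iff {μ : Measure unitInterval} (hβ : 2 ≤ β) [IsProbabilityMeasure μ]
    (hμ : μ ≪ volume) : μ.map (betaMap β) = μ ↔ μ = parryMeasure β := by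
  have := isProbabilityMeasure_parryMeasure hβ
  refine ⟨fun h => ?_, ?_⟩
  · exact eq_of_measurePreserving_betaMap hβ hμ (parryMeasure_absolutelyContinuous β)
      ⟨measurable_betaMap β, h⟩ (measurePreserving_parryMeasure hβ)
  · rintro rfl
    exact (measurePreserving_parryMeasure hβ).map_eq

/-! ### Continuity of the mean in the slope -/

lemma quasiMeasurePreserving_betaMap (hβ : 2 ≤ β) :
    Measure.QuasiMeasurePreserving (betaMap β) volume volume :=
  (measurePreserving_parryMeasure hβ).quasiMeasurePreserving.mono
    (absolutelyContinuous_parryMeasure hβ) (parryMeasure_absolutelyContinuous β)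

lemma ae_fract_mul_ne_zero (hβ : 2 ≤ β) :
    ∀ᵐ x : unitInterval, Int.fract (β * (x : ℝ)) ≠ 0 := by
  have h : (range fun k : ℤ => (k : ℝ) / β).Countable := countable_range _
  have h1 : ((↑) ⁻¹' (range fun k : ℤ => (k : ℝ) / β) : Set unitInterval).Countable :=
    h.preimage Subtype.val_injective
  filter_upwards [compl_mem_ae_iff.2 (h1.measure_zero volume)] with x hx h0
  refine hx ⟨⌊β * x⌋, ?_⟩
  have := Int.floor_add_fract (β * (x : ℝ))
  rw [h0, add_zero] at this
  simp only [this]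
  field_simp

lemma continuousAt_fract_of_ne_zero {x : ℝ} (hx : Int.fract x ≠ 0) :
    ContinuousAt (Int.fract : ℝ → ℝ) x :=
  continuousAt_fract fun h => hx (by rw [h, Int.fract_intCast])

/-- Continuity can fail only if some `β T^k x` is an integer. This is a countable condition on `T^k
x`, and preimages under `T^k` of null sets are null. -/
lemma ae_continuousAt_iterate_betaMap (hβ : 2 ≤ β) :
    ∀ᵐ x : unitInterval, ∀ k : ℕ, ContinuousAt (fun b : ℝ => (((betaMap b)^[k] x : _) : ℝ)) β := by
  have h (k : ℕ) : ∀ᵐ x : unitInterval, Int.fract (β * ((betaMap β)^[k] x : ℝ)) ≠ 0 :=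
    ((quasiMeasurePreserving_betaMap hβ).iterate k).ae (ae_fract_mul_ne_zero hβ)
  filter_upwards [ae_all_iff.2 h] with x hx k
  induction k with
  | zero => exact continuousAt_const
  | succ k ih =>
    simp only [Function.iterate_succ_apply', coe_betaMap]
    exact ContinuousAt.comp (g := Int.fract) (continuousAt_fract_of_ne_zero (hx k))
      (continuousAt_id.mul ih)

lemma continuousAt_integral_birkhoffAverage (hβ : 2 ≤ β) (n : ℕ) :
    ContinuousAt (fun b => ∫ x, birkhoffAverage ℝ (betaMap b) ((↑) : unitInterval → ℝ) n x) β := by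
  refine continuousAt_of_dominated (bound := fun _ => 1) ?_ ?_ (integrable_const _) ?_
  · exact Eventually.of_forall fun b =>
      (measurable_birkhoffAverage (measurable_betaMap b)
        measurable_subtype_coe n).aestronglyMeasurable
  · exact Eventually.of_forall fun b => Eventually.of_forall fun x =>
      abs_birkhoffAverage_le abs_coe_le_one n x
  · filter_upwards [ae_continuousAt_iterate_betaMap hβ] with x hx
    simp only [birkhoffAverage, birkhoffSum, smul_eq_mul]
    exact continuousAt_const.mul (tendsto_finsetSum _ fun k _ => hx k)

/-- Lebesgue averages of Birkhoff averages approximate the mean of the invariant measure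
uniformly in `β`. -/
lemma abs_mean_parryMeasure_sub_le (hβ : 2 ≤ β) {n : ℕ} (hn : n ≠ 0) :
    |mean (parryMeasure β) - ∫ x, birkhoffAverage ℝ (betaMap β) ((↑) : unitInterval → ℝ) n x|
      ≤ 8 / n := by
  have := isProbabilityMeasure_parryMeasure hβ
  have h0 : 0 ≤ β := by linarith
  set ψ := birkhoffAverage ℝ (betaMap β) ((↑) : unitInterval → ℝ) n with hψ
  have hψm : Measurable ψ := measurable_birkhoffAverage (measurable_betaMap β)
    measurable_subtype_coe n
  have hψC : ∀ x, |ψ x| ≤ 1 := abs_birkhoffAverage_le abs_coe_le_one n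
  have hM := one_le_parryMass hβ
  have h1 : mean (parryMeasure β) = (parryMass β)⁻¹ * ∫ x, ψ x ∂(parrySum β) := by
    rw [← integral_parryMeasure hβ, mean, ← integral_birkhoffAverage
      (measurePreserving_parryMeasure hβ) measurable_subtype_coe abs_coe_le_one hn]
  have h2 := hasSum_integral_parrySum hβ hψm hψC
  have h3 := (summable_parryMass hβ).hasSum.mul_right (∫ x, ψ x)
  have h4 := h2.sub h3
  have h5 : |(∫ x, ψ x ∂(parrySum β)) - parryMass β * ∫ x, ψ x| ≤ 8 / n := by
    refine (h4.norm_le_of_bounded ((hasSum_inv_pow hβ).mul_right (4 * 1 / n : ℝ))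
      fun k => ?_).trans ?_
    · rw [mul_assoc, ← mul_sub, norm_mul, Real.norm_of_nonneg (by positivity)]
      gcongr
      exact abs_setIntegral_birkhoffAverage_sub_le hβ measurable_subtype_coe abs_coe_le_one n _
    · have := tsum_inv_pow_le hβ
      rw [(hasSum_inv_pow hβ).tsum_eq] at this
      calc _ ≤ 2 * (4 * 1 / n : ℝ) := by gcongr
        _ = 8 / n := by ring
  have h6 : mean (parryMeasure β) - ∫ x, ψ x
      = (parryMass β)⁻¹ * ((∫ x, ψ x ∂(parrySum β)) - parryMass β * ∫ x, ψ x) := by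
    rw [h1]; field_simp
  rw [h6, abs_mul, abs_of_pos (by positivity)]
  exact (mul_le_of_le_one_left (abs_nonneg _) (inv_le_one_of_one_le₀ hM)).trans h5

/-- A uniform limit of functions continuous at each `β ≥ 2`. -/
lemma continuousOn_mean_parryMeasure :
    ContinuousOn (fun β => mean (parryMeasure β)) (Ici 2) := by
  have h : TendstoUniformlyOn
      (fun (n : ℕ) b => ∫ x, birkhoffAverage ℝ (betaMap b) ((↑) : unitInterval → ℝ) n x)
      (fun β => mean (parryMeasure β)) atTop (Ici 2) := by
    rw [Metric.tendstoUniformlyOn_iff]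
    intro ε hε
    filter_upwards [(tendsto_const_div_atTop_nhds_zero_nat 8).eventually_lt_const hε,
      eventually_ne_atTop 0] with n hn hn0 β hβ
    exact (abs_mean_parryMeasure_sub_le hβ hn0).trans_lt hn
  refine h.continuousOn (Frequently.of_forall fun n β hβ => ?_)
  exact (continuousAt_integral_birkhoffAverage hβ n).continuousWithinAt

/-! ### Size of the displacement -/

/-- For `β < 3` the orbit leaves `β - 2` with growth at most `β` per step, offset by the weights
`β⁻¹ ^ k`: each term after the first is at most `β - 2`. The bound uses this for `N` terms and a
geometric tail for the rest. -/
lemma parryMass_sub_one_le (hβ : 2 ≤ β) (N : ℕ) :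
    parryMass β - 1 ≤ N * (β - 2) + 2 * (1 / 2) ^ N := by
  have h0 : 0 ≤ β := by linarith
  have horb (hβ3 : β < 3) (k : ℕ) : (orbitOne β (k + 1) : ℝ) ≤ β ^ k * (β - 2) := by
    induction k with
    | zero =>
      have h2 : ⌊β⌋ = 2 := by
        rw [Int.floor_eq_iff]; constructor <;> push_cast <;> linarith
      rw [orbitOne_succ, orbitOne_zero, coe_betaMap, Int.fract,
        show ((1 : unitInterval) : ℝ) = 1 from rfl, mul_one, h2]
      simp
    | succ k ih =>
      rw [orbitOne_succ, coe_betaMap]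
      have h1 : 0 ≤ β * (orbitOne β (k + 1) : ℝ) := mul_nonneg h0 (orbitOne β (k + 1)).2.1
      have h2 : Int.fract (β * (orbitOne β (k + 1) : ℝ)) ≤ β * (orbitOne β (k + 1) : ℝ) := by
        rw [Int.fract]
        have : (0 : ℝ) ≤ ⌊β * (orbitOne β (k + 1) : ℝ)⌋ := by
          exact_mod_cast Int.floor_nonneg.2 h1
        linarith
      refine h2.trans ?_
      rw [pow_succ', mul_assoc]
      gcongr
  have hterm (k : ℕ) : β⁻¹ ^ (k + 1) * (orbitOne β (k + 1) : ℝ) ≤ β - 2 := by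
    rcases lt_or_ge β 3 with hβ3 | hβ3
    · calc β⁻¹ ^ (k + 1) * (orbitOne β (k + 1) : ℝ) ≤ β⁻¹ ^ (k + 1) * (β ^ k * (β - 2)) := by
            gcongr; exact horb hβ3 k
        _ = β⁻¹ * (β - 2) := by
            rw [pow_succ, inv_pow]; field_simp
        _ ≤ β - 2 := mul_le_of_le_one_left (by linarith) (inv_le_one_of_one_le₀ (by linarith))
    · have h1 : β⁻¹ ^ (k + 1) ≤ 1 :=
        pow_le_one₀ (by positivity) (inv_le_one_of_one_le₀ (by linarith))
      have h2 := mul_le_one₀ h1 (orbitOne β (k + 1)).2.1 (orbitOne β (k + 1)).2.2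
      linarith
  have hs := summable_parryMass hβ
  have h1 : parryMass β - 1 = ∑' k, β⁻¹ ^ (k + 1) * (orbitOne β (k + 1) : ℝ) := by
    rw [parryMass, hs.tsum_eq_zero_add]
    simp [orbitOne_zero]
  have hs1 := (summable_nat_add_iff 1).2 hs
  rw [h1, ← hs1.sum_add_tsum_nat_add N]
  have h2 : ∑ k ∈ Finset.range N, β⁻¹ ^ (k + 1) * (orbitOne β (k + 1) : ℝ) ≤ N * (β - 2) := by
    have := Finset.sum_le_sum fun k (_ : k ∈ Finset.range N) => hterm k
    rwa [Finset.sum_const, Finset.card_range, nsmul_eq_mul] at this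
  have hg := hasSum_geometric_two.mul_left ((1 / 2 : ℝ) ^ N)
  have h3 : ∑' k, β⁻¹ ^ (k + N + 1) * (orbitOne β (k + N + 1) : ℝ) ≤ (1 / 2) ^ N * 2 := by
    rw [← hg.tsum_eq]
    refine ((summable_nat_add_iff N).2 hs1).tsum_le_tsum (fun k => ?_) hg.summable
    calc β⁻¹ ^ (k + N + 1) * (orbitOne β (k + N + 1) : ℝ) ≤ (1 / 2) ^ (k + N + 1) * 1 :=
          mul_le_mul (inv_pow_le hβ _) (orbitOne β _).2.2 (orbitOne β _).2.1 (by positivity)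
      _ ≤ (1 / 2) ^ N * (1 / 2) ^ k := by
          rw [mul_one, ← pow_add, add_comm N k]
          exact pow_le_pow_of_le_one (by norm_num) (by norm_num) (by omega)
  linarith

/-- The displacement `1 / E - 2` of the mean `E` of the absolutely continuous invariant probability
measure of `x ↦ β x mod 1`. -/
noncomputable def displacement (β : ℝ) : ℝ := 1 / mean (parryMeasure β) - 2

lemma displacement_nonneg (hβ : 2 ≤ β) : 0 ≤ displacement β := by
  have h1 := one_le_parryMoment hβ
  have h2 := parryMoment_le_parryMass hβ
  rw [displacement, one_div_mean_parryMeasure_sub hβ]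
  exact div_nonneg (by linarith) (by linarith)

lemma displacement_le (hβ : 2 ≤ β) : displacement β ≤ 2 * (parryMass β - 1) := by
  have h1 := one_le_parryMoment hβ
  have h2 := one_le_parryMass hβ
  rw [displacement, one_div_mean_parryMeasure_sub hβ, div_le_iff₀ (by linarith)]
  nlinarith

lemma displacement_le_two (hβ : 2 ≤ β) : displacement β ≤ 2 := by
  linarith [displacement_le hβ, parryMass_le_two hβ]

lemma displacement_two : displacement 2 = 0 := by
  have h : ∫ x : unitInterval, (x : ℝ) = 1 / 2 := by
    rw [← setIntegral_univ, ← Iic_one, setIntegral_Iic_coe (fun x => x)]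
    simp
  rw [displacement, parryMeasure_two, mean, h]
  norm_num

/-- The orbit point `1/2` lies strictly inside `(0,1)`, so its square is smaller and the moment is
strictly below the mass. -/
lemma displacement_five_halves_pos : 0 < displacement (5 / 2) := by
  have hβ : (2 : ℝ) ≤ 5 / 2 := by norm_num
  have h1 := one_le_parryMoment hβ
  have hx : (orbitOne (5 / 2) 1 : ℝ) = 1 / 2 := by
    rw [orbitOne_succ, orbitOne_zero, coe_betaMap, show ((1 : unitInterval) : ℝ) = 1 from rfl,
      mul_one, Int.fract, show ⌊(5 / 2 : ℝ)⌋ = 2 by rw [Int.floor_eq_iff]; norm_num]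
    norm_num
  have h2 : parryMoment (5 / 2) < parryMass (5 / 2) := by
    refine Summable.tsum_lt_tsum (i := 1) (fun k => ?_) ?_ (summable_parryMoment hβ)
      (summable_parryMass hβ)
    · have h := (orbitOne (5 / 2) k).2
      have : (orbitOne (5 / 2) k : ℝ) ^ 2 ≤ orbitOne (5 / 2) k := by nlinarith [h.1, h.2]
      gcongr
    · rw [hx]; norm_num
  rw [displacement, one_div_mean_parryMeasure_sub hβ]
  exact div_pos (by linarith) (by linarith)

lemma continuousOn_displacement : ContinuousOn displacement (Ici 2) := by
  refine (continuousOn_const.div continuousOn_mean_parryMeasure fun β hβ => ?_).sub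
    continuousOn_const
  have h1 := one_le_parryMoment hβ
  have h2 := one_le_parryMass hβ
  rw [mean_parryMeasure hβ]
  positivity

lemma displacement_le_mul_log (hβ : 2 < β) (hβ' : β - 2 ≤ Real.exp (-1)) :
    displacement β ≤ 10 * ((β - 2) * -Real.log (β - 2)) := by
  set δ := β - 2 with hδ
  have hδ0 : 0 < δ := by linarith
  -- As `log 2 > 1/2`, this cutoff makes the tail `(1/2)^N` at most `δ`.
  set N := ⌈2 * -Real.log δ⌉₊ with hN
  have hL : 1 ≤ -Real.log δ := by
    have := Real.log_le_log hδ0 hβ'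
    rw [Real.log_exp] at this
    linarith
  have hN1 : (N : ℝ) < 2 * -Real.log δ + 1 := Nat.ceil_lt_add_one (by linarith)
  have hN2 : 2 * -Real.log δ ≤ N := Nat.le_ceil _
  have hp : (1 / 2 : ℝ) ^ N ≤ δ := by
    rw [← Real.log_le_log_iff (by positivity) hδ0, Real.log_pow, one_div, Real.log_inv]
    have := Real.log_two_gt_d9
    nlinarith
  have h1 := displacement_le hβ.le
  have h2 := parryMass_sub_one_le hβ.le N
  have h3 : (N : ℝ) * δ ≤ (2 * -Real.log δ + 1) * δ := by gcongr
  rw [← hδ] at h2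
  nlinarith

/-! ### Reduction to a scalar equation -/

/-- Absolutely continuous invariant measures of the self-consistent system correspond to the
solutions of a scalar equation for the slope. -/
lemma isAcim_iff {F : ℝ → ℝ} (hF : ∀ x, 0 ≤ F x) {ε : ℝ} (hε : 0 ≤ ε)
    {μ : Measure unitInterval} :
    IsAcim F ε μ ↔ ∃ β, 2 ≤ β ∧ β = 2 + ε * F (displacement β) ∧ μ = parryMeasure β := by
  -- The Dirac convention never applies, since `δ_0` charges a null set.
  have hdyn (ν : Measure unitInterval) (hν : ν ≪ volume) :
      dynamics F ε ν = betaMap (2 + ε * F (1 / mean ν - 2)) := by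
    refine if_neg fun h => ?_
    have := hν (measure_singleton (0 : unitInterval))
    simp [h] at this
  constructor
  · intro h
    have := h.isInvariant.isProbabilityMeasure
    have hmap := h.isInvariant.map_eq
    rw [hdyn μ h.absolutelyContinuous] at hmap
    have hβ : 2 ≤ 2 + ε * F (1 / mean μ - 2) := by linarith [mul_nonneg hε (hF (1 / mean μ - 2))]
    have hμ := (map_betaMap_eq_iff hβ h.absolutelyContinuous).1 hmap
    refine ⟨_, hβ, ?_, hμ⟩
    rw [displacement, ← hμ]
  · rintro ⟨β, hβ, heq, rfl⟩
    have hac := parryMeasure_absolutelyContinuous β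
    have := isProbabilityMeasure_parryMeasure hβ
    refine ⟨⟨this, ?_⟩, hac⟩
    rw [hdyn _ hac, ← displacement, ← heq]
    exact (map_betaMap_eq_iff hβ hac).2 rfl

/-! ### Solving the slope equation -/

namespace IsAdmissible

variable {F : ℝ → ℝ}

lemma nonneg (hF : IsAdmissible F) (x : ℝ) : 0 ≤ F x := by
  rcases eq_or_ne x 0 with rfl | hx
  · exact hF.map_zero.ge
  · exact (hF.pos x hx).le

/-- Mean value theorem on `[0, x]`: the intermediate point is smaller than `x`, so its `1/|log|` is
smaller too. -/
lemma exists_le_div_log (hF : IsAdmissible F) :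
    ∃ C > 0, ∃ r > 0, r ≤ 1 ∧ ∀ x, 0 < x → x < r → F x ≤ C * x / -Real.log x := by
  obtain ⟨C, hC, hb⟩ := hF.deriv_isBigO.exists_pos
  obtain ⟨r, hr, hb⟩ := mem_nhdsGT_iff_exists_Ioo_subset.1 hb.bound
  refine ⟨C, hC, min r 1, lt_min hr one_pos, min_le_right _ _, fun x hx hxr => ?_⟩
  obtain ⟨hxr, hx1⟩ := lt_min_iff.1 hxr
  have hd : Differentiable ℝ F := hF.contDiff.differentiable (by norm_num)
  obtain ⟨ξ, hξ, hξ'⟩ := exists_deriv_eq_slope F hx hd.continuous.continuousOn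
    hd.differentiableOn
  have h1 := hb ⟨hξ.1, hξ.2.trans hxr⟩
  have hlx : Real.log x < 0 := Real.log_neg hx hx1
  have hlξ : Real.log ξ < Real.log x := Real.log_lt_log hξ.1 hξ.2
  have h1 : |deriv F ξ| ≤ C * ‖1 / |Real.log ξ|‖ := h1
  rw [Real.norm_of_nonneg (by positivity), abs_of_neg (hlξ.trans hlx)] at h1
  have h2 : F x = deriv F ξ * x := by
    rw [hξ', hF.map_zero, sub_zero, sub_zero, div_mul_cancel₀ _ hx.ne']
  calc F x = deriv F ξ * x := h2
    _ ≤ C * (1 / -Real.log ξ) * x := by gcongr; exact (le_abs_self _).trans h1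
    _ ≤ C * (1 / -Real.log x) * x := by gcongr; linarith
    _ = C * x / -Real.log x := by ring

/-- For small `δ`, `10 δ |log δ| ≤ √δ`, so `|log x| ≥ |log δ| / 2`, which cancels the logarithm in
the bound on `x`. -/
lemma exists_eventually_le_mul (hF : IsAdmissible F) :
    ∃ K > 0, ∀ᶠ δ in 𝓝[>] (0 : ℝ), ∀ x, 0 < x → x ≤ 10 * (δ * -Real.log δ) → F x ≤ K * δ := by
  obtain ⟨C, hC, r, hr, hr1, hb⟩ := hF.exists_le_div_log
  refine ⟨20 * C, by positivity, ?_⟩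
  have h1 : ∀ᶠ δ in 𝓝[>] (0 : ℝ), -(1 / 10) < Real.log δ * δ ^ (1 / 2 : ℝ) :=
    (tendsto_log_mul_rpow_nhdsGT_zero (by norm_num)).eventually_const_lt (by norm_num)
  have h2 : ∀ᶠ δ in 𝓝[>] (0 : ℝ), δ < r ^ 2 :=
    (eventually_lt_nhds (by positivity)).filter_mono nhdsWithin_le_nhds
  filter_upwards [h1, h2, self_mem_nhdsWithin] with δ h1 h2 (hδ : 0 < δ) x hx hxδ
  rw [← Real.sqrt_eq_rpow] at h1
  have hs : 0 < √δ := Real.sqrt_pos.2 hδ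
  have hsr : √δ < r := (Real.sqrt_lt' hr).2 h2
  have hxs : x ≤ √δ := by
    have := Real.mul_self_sqrt hδ.le
    nlinarith
  have hδ1 : √δ < 1 := hsr.trans_le hr1
  have hl : Real.log x ≤ Real.log δ / 2 := by
    rw [← Real.log_sqrt hδ.le]; exact Real.log_le_log hx hxs
  have hl0 : Real.log δ < 0 := by
    have := Real.log_neg hs hδ1
    rw [Real.log_sqrt hδ.le] at this
    linarith
  refine (hb x hx (hxs.trans_lt hsr)).trans ?_
  rw [div_le_iff₀ (by linarith)]
  calc C * x ≤ C * (10 * (δ * -Real.log δ)) := by gcongr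
    _ = 20 * C * δ * -(Real.log δ / 2) := by ring
    _ ≤ 20 * C * δ * -Real.log x := by gcongr

lemma exists_bound (hF : IsAdmissible F) :
    ∃ M > 0, ∀ β, 2 ≤ β → F (displacement β) ≤ M := by
  obtain ⟨M, hM⟩ := (isCompact_Icc (a := (0 : ℝ)) (b := 2)).bddAbove_image
    hF.contDiff.continuous.continuousOn
  refine ⟨max M 1, by positivity, fun β hβ => le_max_of_le_left (hM ⟨_, ?_, rfl⟩)⟩
  exact ⟨displacement_nonneg hβ, displacement_le_two hβ⟩

lemma exists_slope_eq_two (hF : IsAdmissible F) :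
    ∃ ε₁ > 0, ∀ ε, 0 ≤ ε → ε < ε₁ → ∀ β, 2 ≤ β → β = 2 + ε * F (displacement β) → β = 2 := by
  obtain ⟨K, hK, hb⟩ := hF.exists_eventually_le_mul
  obtain ⟨M, hM, hbM⟩ := hF.exists_bound
  obtain ⟨r, hr, hb⟩ := mem_nhdsGT_iff_exists_Ioo_subset.1 hb
  have hr : 0 < r := hr
  have he : 0 < Real.exp (-1) := Real.exp_pos _
  -- The second bound forces `β - 2 ≤ ε M` into the range of the local estimates; the first makes `ε
  -- K < 1`, contradicting `β - 2 ≤ ε K (β - 2)`.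
  refine ⟨min K⁻¹ (min r (Real.exp (-1)) / M), by positivity, fun ε hε0 hε β hβ heq => ?_⟩
  by_contra hne
  have hβ2 : 2 < β := lt_of_le_of_ne hβ (Ne.symm hne)
  obtain ⟨hεK, hεM⟩ := lt_min_iff.1 hε
  rw [lt_div_iff₀ hM] at hεM
  have hδM : β - 2 < min r (Real.exp (-1)) := by
    have := mul_le_mul_of_nonneg_left (hbM β hβ) hε0
    linarith
  obtain ⟨hδr, hδe⟩ := lt_min_iff.1 hδM
  have hg : 0 < displacement β := by
    refine lt_of_le_of_ne (displacement_nonneg hβ) fun h => hne ?_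
    rw [heq, ← h, hF.map_zero]
    simp
  have h1 := hb ⟨by linarith, hδr⟩ _ hg (displacement_le_mul_log hβ2 hδe.le)
  have h2 : ε * F (displacement β) ≤ ε * (K * (β - 2)) := by gcongr
  have h3 : ε * K < 1 := by
    rwa [← one_div, lt_div_iff₀ hK] at hεK
  nlinarith

lemma exists_slope_gt_two (hF : IsAdmissible F) {ε : ℝ} (hε : 0 ≤ ε)
    (hε' : 1 / 2 ≤ ε * F (displacement (5 / 2))) :
    ∃ β, 2 < β ∧ β = 2 + ε * F (displacement β) := by
  obtain ⟨M, hM, hbM⟩ := hF.exists_bound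
  have hεM : 0 ≤ ε * M := by positivity
  have hcont : ContinuousOn (fun β => ε * F (displacement β) - (β - 2))
      (Icc (5 / 2) (3 + ε * M)) := by
    refine (continuousOn_const.mul (hF.contDiff.continuous.comp_continuousOn
      (continuousOn_displacement.mono fun β hβ => ?_))).sub (by fun_prop)
    exact le_trans (by norm_num) hβ.1
  have hM' := mul_le_mul_of_nonneg_left (hbM (3 + ε * M) (by linarith)) hε
  -- The function is nonnegative at `5/2` by `hε'` and at most `-1` at `3 + ε M`.
  obtain ⟨β, hβ, h0⟩ := intermediate_value_Icc' (by linarith) hcont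
    (show (0 : ℝ) ∈ _ from ⟨by linarith, by linarith⟩)
  exact ⟨β, by linarith [hβ.1], by simp only at h0; linarith⟩

end IsAdmissible

lemma isAdmissible_pow {k : ℕ} (hk : 1 ≤ k) : IsAdmissible fun x : ℝ => x ^ (2 * k) where
  contDiff := contDiff_id.pow _
  map_zero := by simp; omega
  pos x hx := (even_two_mul k).pow_pos hx
  deriv_isBigO := by
    refine IsBigO.of_bound (2 * k) ?_
    filter_upwards [Ioo_mem_nhdsGT (zero_lt_one' ℝ)] with x hx
    have hl : 0 < |Real.log x| := abs_pos.2 (Real.log_neg hx.1 hx.2).ne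
    have h1 := (Real.abs_log_mul_self_lt x hx.1 hx.2.le).le
    rw [abs_mul, abs_of_pos hx.1] at h1
    have h2 : x ^ (2 * k - 1) ≤ x := pow_le_of_le_one hx.1.le hx.2.le (by omega)
    have hx0 := hx.1
    rw [deriv_pow_field, Real.norm_of_nonneg (by positivity), Real.norm_of_nonneg (by positivity)]
    push_cast
    gcongr
    rw [le_div_iff₀ hl]
    nlinarith

end SelfConsistent

theorem theorem2 :
    (∀ F : ℝ → ℝ, SelfConsistent.IsAdmissible F →
      ∃ ε₁ : ℝ, 0 < ε₁ ∧
        (∀ ε : ℝ, 0 ≤ ε → ε < ε₁ →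
          ∀ μ : Measure unitInterval, SelfConsistent.IsAcim F ε μ ↔ μ = volume) ∧
        ∃ ε₂ : ℝ, ε₁ ≤ ε₂ ∧
          ∀ ε : ℝ, ε₂ ≤ ε →
            SelfConsistent.IsAcim F ε volume ∧
            ∃ μ : Measure unitInterval, SelfConsistent.IsAcim F ε μ ∧ μ ≠ volume ∧
              μ ≪ volume ∧ volume ≪ μ) ∧
    (∀ k : ℕ, 1 ≤ k → SelfConsistent.IsAdmissible (fun x : ℝ => x ^ (2 * k))) := by
  refine ⟨fun F hF => ?_, fun k hk => SelfConsistent.isAdmissible_pow hk⟩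
  have hvol (ε : ℝ) (hε : 0 ≤ ε) : SelfConsistent.IsAcim F ε volume := by
    refine (SelfConsistent.isAcim_iff hF.nonneg hε).2
      ⟨2, le_rfl, ?_, SelfConsistent.parryMeasure_two.symm⟩
    rw [SelfConsistent.displacement_two, hF.map_zero]
    simp
  obtain ⟨ε₁, hε₁, h₁⟩ := hF.exists_slope_eq_two
  have hpos := hF.pos _ SelfConsistent.displacement_five_halves_pos.ne'
  refine ⟨ε₁, hε₁, fun ε hε hεlt μ => ⟨fun h => ?_, ?_⟩,
    max ε₁ (1 / 2 / F (SelfConsistent.displacement (5 / 2))), le_max_left _ _, fun ε hε => ?_⟩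
  · obtain ⟨β, hβ, heq, rfl⟩ := (SelfConsistent.isAcim_iff hF.nonneg hε).1 h
    rw [h₁ ε hε hεlt β hβ heq, SelfConsistent.parryMeasure_two]
  · rintro rfl
    exact hvol ε hε
  · obtain ⟨hε1, hε2⟩ := max_le_iff.1 hε
    have hε0 : 0 ≤ ε := hε₁.le.trans hε1
    obtain ⟨β, hβ, heq⟩ := hF.exists_slope_gt_two hε0 ((div_le_iff₀ hpos).1 hε2)
    refine ⟨hvol ε hε0, SelfConsistent.parryMeasure β,
      (SelfConsistent.isAcim_iff hF.nonneg hε0).2 ⟨β, hβ.le, heq, rfl⟩, fun h => ?_,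
      SelfConsistent.parryMeasure_absolutelyContinuous β,
      SelfConsistent.absolutelyContinuous_parryMeasure hβ.le⟩
    -- If the measure were Lebesgue, the displacement would vanish and the equation would give `β =
    -- 2`.
    have h2 : SelfConsistent.displacement β = SelfConsistent.displacement 2 := by
      rw [SelfConsistent.displacement, h, ← SelfConsistent.parryMeasure_two]
      rfl
    rw [h2, SelfConsistent.displacement_two, hF.map_zero] at heq
    linarith
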